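/- There is an absolute constant $C>0$ such that the following holds. Let $m>1$ and $n$ be integers, let $\varepsilon>0$, and let $k$ be an even integer with $k\ge C\,m^4/\varepsilon^2$. For $i=1,\dots,m$ let $H_i=\{x\in\mathbb{R}^n:\langle a_i,x\rangle>\theta_i\}$, where $a_i\in\mathbb{R}^n$ with $\|a_i\|_2=1$ and $\theta_i\in\mathbb{R}$. Let $X$ be a random vector in $\mathbb{R}^n$ whose coordinates are independent standard normals, and let $Y$ be a random vector in $\mathbb{R}^n$ whose coordinates are $k$-wise independent standard normals (each coordinate is standard normal, and any at most $k$ of the coordinates are mutually independent). Then $$\Bigl|\Pr\bigl[X\in\textstyle\bigcap_{i=1}^m H_i\bigr]-\Pr\bigl[Y\in\textstyle\bigcap_{i=1}^m H_i\bigr]\Bigr|<\varepsilon .$$ -/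

import Mathlib

open MeasureTheory ProbabilityTheory

/-- The open halfspace `{x : ⟨a, x⟩ > θ}` in `ℝⁿ`. -/
def openHalfspace {n : ℕ} (a : EuclideanSpace ℝ (Fin n)) (θ : ℝ) :
    Set (EuclideanSpace ℝ (Fin n)) :=
  {x | inner ℝ a x > θ}

/-- `X` is a random vector whose coordinates are independent standard normals. -/
structure IsIndepStdNormals {n : ℕ} {Ω : Type*} [MeasurableSpace Ω]
    (X : Ω → EuclideanSpace ℝ (Fin n)) (P : Measure Ω) : Prop where
  hasLaw : ∀ i, HasLaw (fun ω => X ω i) (gaussianReal 0 1) P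
  indep : iIndepFun (fun i ω => X ω i) P

/-- `Y` is a random vector whose coordinates are `k`-wise independent standard normals: each
coordinate is a standard normal, and any at most `k` of the coordinates are independent. -/
structure IsKWiseIndepStdNormals {n : ℕ} (k : ℕ) {Ω : Type*} [MeasurableSpace Ω]
    (Y : Ω → EuclideanSpace ℝ (Fin n)) (P : Measure Ω) : Prop where
  hasLaw : ∀ i, HasLaw (fun ω => Y ω i) (gaussianReal 0 1) P
  indep : ∀ S : Finset (Fin n), S.card ≤ k → iIndepFun (fun (i : S) ω => Y ω i) P

/-! The linear forms `⟨a_i, x⟩` turn the intersection of halfspaces into an orthant in `ℝ^m`. Under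
`k`-wise independence every polynomial of degree at most `k` in these forms has the same expectation
as under full independence (`momentsMatch_map_inner`), so it suffices to replace the orthant
indicator by something well approximated by polynomials.

Each one-dimensional indicator is replaced by `sincCdf (c * (t - θ))`, whose `j`-th derivative is at
most `(D * c) ^ j`. Products of such functions keep bounds of this shape. Taylor expansion along
rays from the origin leaves a remainder of order `(D * c * ∑ |x_i|) ^ k / k!`, and Gaussian moments
make its mean exponentially small when `c` is a small multiple of `√k / m`
(`MomentsMatch.abs_integral_prod_sub_le`, `integral_pow_gaussianReal_le`).

The smoothing error is dominated by `K * sincSqSum`, an integrable function that is itself a sum of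
two functions with derivative bounds. Its Gaussian mean is `O(1 / c)`, and the Taylor argument
transfers this anticoncentration to the `k`-wise independent vector. Summing over `m` halfspaces
gives a total error `O(m / c) = O(m ^ 2 / √k)`, whence the condition `k ≥ C m ^ 4 / ε ^ 2`. -/

/-! ### Functions with geometrically bounded derivatives -/

/-- `f` is smooth and its `j`-th derivative is bounded by `A ^ j`, for every `j`. -/
structure DerivBound (f : ℝ → ℝ) (A : ℝ) : Prop where
  contDiff : ∀ n : ℕ, ContDiff ℝ n f
  bound : ∀ (j : ℕ) (x : ℝ), |iteratedDeriv j f x| ≤ A ^ j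

namespace DerivBound

variable {f g : ℝ → ℝ} {A B : ℝ}

lemma nonneg (hf : DerivBound f A) : 0 ≤ A := by
  simpa using (abs_nonneg _).trans (hf.bound 1 0)

lemma abs_le_one (hf : DerivBound f A) (x : ℝ) : |f x| ≤ 1 := by
  simpa using hf.bound 0 x

lemma continuous (hf : DerivBound f A) : Continuous f :=
  (hf.contDiff 0).continuous

lemma mono (hf : DerivBound f A) (h : A ≤ B) : DerivBound f B :=
  ⟨hf.contDiff, fun j x => (hf.bound j x).trans (pow_le_pow_left₀ hf.nonneg h j)⟩

lemma one : DerivBound (fun _ => 1) 0 := by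
  refine ⟨fun n => contDiff_const, fun j x => ?_⟩
  rw [iteratedDeriv_const]
  split_ifs with h <;> simp [h]

/-- By Leibniz's rule the bounds combine into the binomial expansion of `(A + B) ^ j`. -/
lemma mul (hf : DerivBound f A) (hg : DerivBound g B) :
    DerivBound (fun x => f x * g x) (A + B) := by
  refine ⟨fun n => (hf.contDiff n).mul (hg.contDiff n), fun j x => ?_⟩
  rw [iteratedDeriv_fun_mul (hf.contDiff j).contDiffAt (hg.contDiff j).contDiffAt, add_pow]
  refine (Finset.abs_sum_le_sum_abs _ _).trans (Finset.sum_le_sum fun i _ => ?_)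
  rw [abs_mul, abs_mul, Nat.abs_cast]
  calc _ ≤ (j.choose i : ℝ) * A ^ i * B ^ (j - i) := by
        gcongr
        · exact mul_nonneg (Nat.cast_nonneg _) (pow_nonneg hf.nonneg _)
        · exact hf.bound i x
        · exact hg.bound _ x
    _ = _ := by ring

lemma prod {ι : Type*} (s : Finset ι) {f : ι → ℝ → ℝ} {A : ι → ℝ}
    (hf : ∀ i ∈ s, DerivBound (f i) (A i)) :
    DerivBound (fun x => ∏ i ∈ s, f i x) (∑ i ∈ s, A i) := by
  classical
  induction s using Finset.induction_on with
  | empty => simpa using one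
  | insert a s ha ih =>
    simp only [Finset.prod_insert ha, Finset.sum_insert ha]
    exact (hf a (by simp)).mul (ih fun i hi => hf i (by simp [hi]))

lemma pow (hf : DerivBound f A) (n : ℕ) : DerivBound (fun x => f x ^ n) (n * A) := by
  simpa using prod (Finset.range n) (f := fun _ => f) (A := fun _ => A) fun _ _ => hf

lemma comp_mul_const (hf : DerivBound f A) (a : ℝ) :
    DerivBound (fun x => f (a * x)) (A * |a|) := by
  refine ⟨fun n => (hf.contDiff n).comp (contDiff_const.mul contDiff_id), fun j x => ?_⟩
  rw [iteratedDeriv_comp_const_mul (hf.contDiff j)]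
  simp only [abs_mul, abs_pow]
  rw [mul_pow, mul_comm]
  gcongr
  exact hf.bound j _

lemma comp_sub_const (hf : DerivBound f A) (b : ℝ) :
    DerivBound (fun x => f (x - b)) A := by
  refine ⟨fun n => (hf.contDiff n).comp (contDiff_id.sub contDiff_const), fun j x => ?_⟩
  rw [iteratedDeriv_comp_sub_const]
  exact hf.bound j _

/-- Passing to an antiderivative shifts the order by one: the factor `κ` is absorbed by the extra
power of `B`, and order zero is the separate bound on `f`. -/
lemma of_deriv {f g : ℝ → ℝ} {A : ℝ} {κ : ℝ} (hfg : ∀ x, HasDerivAt f (κ * g x) x)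
    (hf : ∀ x, |f x| ≤ 1) (hg : DerivBound g A) {B : ℝ} (hAB : A ≤ B) (hκ : |κ| ≤ B) :
    DerivBound f B := by
  have hd : deriv f = fun x => κ * g x := funext fun x => (hfg x).deriv
  refine ⟨fun n => ?_, fun j x => ?_⟩
  · have : ContDiff ℝ (n + 1) f :=
      contDiff_succ_iff_deriv.2 ⟨fun x => (hfg x).differentiableAt, by simp,
        hd ▸ contDiff_const.mul (hg.contDiff n)⟩
    exact this.of_le (by simp)
  · cases j with
    | zero => simpa using hf x
    | succ j =>
      rw [iteratedDeriv_succ', hd, iteratedDeriv_const_mul_field, abs_mul, pow_succ']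
      have := hg.nonneg
      gcongr
      · exact (abs_nonneg _).trans hκ
      · exact ((hg.bound j x).trans (pow_le_pow_left₀ this hAB j))

/-- Lagrange's remainder at `0` for a function with bounded derivatives. -/
lemma abs_sub_taylor_le (hf : DerivBound f A) (k : ℕ) (hk : k ≠ 0) :
    |f 1 - ∑ j ∈ Finset.range k, iteratedDeriv j f 0 / j.factorial| ≤ A ^ k / k.factorial := by
  obtain ⟨n, rfl⟩ := Nat.exists_eq_succ_of_ne_zero hk
  obtain ⟨x, -, hx⟩ := taylor_mean_remainder_lagrange_iteratedDeriv (f := f) (x := 1) (x₀ := 0)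
    (n := n) zero_ne_one (by exact_mod_cast (hf.contDiff (n + 1)).contDiffOn)
  have : taylorWithinEval f n (Set.uIcc 0 1) 0 1 =
      ∑ j ∈ Finset.range (n + 1), iteratedDeriv j f 0 / j.factorial := by
    rw [taylor_within_apply]
    refine Finset.sum_congr rfl fun j _ => ?_
    rw [iteratedDerivWithin_eq_iteratedDeriv (uniqueDiffOn_uIcc zero_ne_one)
      (hf.contDiff j).contDiffAt (by simp)]
    simp [div_eq_inv_mul]
  rw [this] at hx
  rw [Nat.succ_eq_add_one, hx, abs_div, Nat.abs_cast]
  simp only [sub_zero, one_pow, mul_one]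
  gcongr
  exact hf.bound _ _

end DerivBound

/-! ### Derivatives of `sinc` -/

lemma abs_integral_pow_mul_cos_le (j : ℕ) (x : ℝ) :
    |∫ t in (0 : ℝ)..1, t ^ j * Real.cos (x * t + j * (Real.pi / 2))| ≤ 1 := by
  have h := intervalIntegral.norm_integral_le_of_norm_le_const (a := 0) (b := 1) (C := 1)
    (f := fun t : ℝ => t ^ j * Real.cos (x * t + j * (Real.pi / 2))) (fun t ht => ?_)
  · simpa using h
  · rw [Set.uIoc_of_le zero_le_one] at ht
    rw [norm_mul, norm_pow, Real.norm_eq_abs, Real.norm_eq_abs, abs_of_pos ht.1]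
    exact mul_le_one₀ (pow_le_one₀ ht.1.le ht.2) (abs_nonneg _) (Real.abs_cos_le_one _)

lemma hasDerivAt_integral_pow_mul_cos (j : ℕ) (x : ℝ) :
    HasDerivAt (fun x => ∫ t in (0 : ℝ)..1, t ^ j * Real.cos (x * t + j * (Real.pi / 2)))
      (∫ t in (0 : ℝ)..1, t ^ (j + 1) * Real.cos (x * t + (j + 1 : ℕ) * (Real.pi / 2))) x := by
  refine (intervalIntegral.hasDerivAt_integral_of_dominated_loc_of_deriv_le
    (F := fun x t => t ^ j * Real.cos (x * t + j * (Real.pi / 2)))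
    (F' := fun x t => t ^ (j + 1) * Real.cos (x * t + (j + 1 : ℕ) * (Real.pi / 2)))
    (bound := fun _ => 1) Filter.univ_mem (Filter.Eventually.of_forall fun x => ?_) ?_ ?_ ?_ ?_
    ?_).2
  · exact Continuous.aestronglyMeasurable (by fun_prop)
  · exact Continuous.intervalIntegrable (by fun_prop) _ _
  · exact Continuous.aestronglyMeasurable (by fun_prop)
  · refine Filter.Eventually.of_forall fun t ht y _ => ?_
    rw [Set.uIoc_of_le zero_le_one] at ht
    rw [norm_mul, norm_pow, Real.norm_eq_abs, Real.norm_eq_abs, abs_of_pos ht.1]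
    exact mul_le_one₀ (pow_le_one₀ ht.1.le ht.2) (abs_nonneg _) (Real.abs_cos_le_one _)
  · simp
  · refine Filter.Eventually.of_forall fun t _ y _ => ?_
    have h := ((((hasDerivAt_id y).mul_const t).add_const (j * (Real.pi / 2))).cos).const_mul (t ^ j)
    refine h.congr_deriv ?_
    push_cast
    rw [add_mul, ← add_assoc, one_mul (Real.pi / 2), Real.cos_add_pi_div_two]
    simp only [id]
    ring

lemma sinc_eq_integral_cos (x : ℝ) : Real.sinc x = ∫ t in (0 : ℝ)..1, Real.cos (x * t) := by
  rcases eq_or_ne x 0 with rfl | hx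
  · simp
  · rw [Real.sinc_of_ne_zero hx, intervalIntegral.integral_comp_mul_left _ hx]
    simp [div_eq_inv_mul]

lemma iteratedDeriv_sinc (j : ℕ) : iteratedDeriv j Real.sinc =
    fun x => ∫ t in (0 : ℝ)..1, t ^ j * Real.cos (x * t + j * (Real.pi / 2)) := by
  induction j with
  | zero => ext x; simp [sinc_eq_integral_cos]
  | succ j ih =>
    rw [iteratedDeriv_succ, ih]
    exact funext fun x => (hasDerivAt_integral_pow_mul_cos j x).deriv

/-- `sinc x` averages `cos (x * t)` over frequencies `t` in `[0, 1]`, so each differentiation only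
brings down a factor `t ≤ 1`. -/
lemma derivBound_sinc : DerivBound Real.sinc 1 := by
  refine ⟨fun n => ?_, fun j x => ?_⟩
  · have : ContDiff ℝ (n : ℕ∞) Real.sinc := by
      refine contDiff_of_differentiable_iteratedDeriv fun j _ => ?_
      rw [iteratedDeriv_sinc]
      exact fun x => (hasDerivAt_integral_pow_mul_cos j x).differentiableAt
    exact_mod_cast this
  · rw [iteratedDeriv_sinc, one_pow]
    exact abs_integral_pow_mul_cos_le j x

lemma sinc_mul_self (x : ℝ) : Real.sinc x * x = Real.sin x := by
  rcases eq_or_ne x 0 with rfl | hx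
  · simp
  · rw [Real.sinc_of_ne_zero hx, div_mul_cancel₀ _ hx]

/-! ### The majorant and the smoothed step function -/

/-- A band-limited integrable function which is bounded below by a multiple of `1 / (1 + t ^ 2)`. -/
noncomputable def sincSqSum (t : ℝ) : ℝ := Real.sinc t ^ 2 + Real.sinc (t - Real.pi / 2) ^ 2

lemma sincSqSum_nonneg (t : ℝ) : 0 ≤ sincSqSum t := by unfold sincSqSum; positivity

/-- The shift by `π / 2` turns sine into cosine, so the two numerators sum to `sin ^ 2 + cos ^ 2 =
1` and the zeros of one term are covered by the other. -/
lemma inv_one_add_sq_le_sincSqSum (t : ℝ) : (1 + t ^ 2)⁻¹ ≤ 5 * sincSqSum t := by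
  rw [inv_le_iff_one_le_mul₀ (by positivity)]
  have h1 := sinc_mul_self t
  have h2 := sinc_mul_self (t - Real.pi / 2)
  rw [Real.sin_sub_pi_div_two] at h2
  have h3 := Real.sin_sq_add_cos_sq t
  have hpi : (Real.pi / 2) ^ 2 ≤ 5 / 2 := by
    have := Real.pi_lt_d2
    nlinarith [Real.pi_pos]
  have h4 : (t - Real.pi / 2) ^ 2 ≤ 5 * (1 + t ^ 2) := by nlinarith [sq_nonneg (t + Real.pi / 2)]
  have h5 : t ^ 2 ≤ 5 * (1 + t ^ 2) := by nlinarith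
  calc (1 : ℝ) = Real.sinc t ^ 2 * t ^ 2
        + Real.sinc (t - Real.pi / 2) ^ 2 * (t - Real.pi / 2) ^ 2 := by
        rw [← mul_pow, ← mul_pow, h1, h2]; linarith
    _ ≤ Real.sinc t ^ 2 * (5 * (1 + t ^ 2))
        + Real.sinc (t - Real.pi / 2) ^ 2 * (5 * (1 + t ^ 2)) := by gcongr
    _ = _ := by unfold sincSqSum; ring

lemma sinc_sq_mul_one_add_sq_le (t : ℝ) : Real.sinc t ^ 2 * (1 + t ^ 2) ≤ 2 := by
  have h1 : Real.sinc t ^ 2 ≤ 1 := (sq_le_one_iff_abs_le_one _).2 (Real.abs_sinc_le_one t)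
  have h2 : Real.sinc t ^ 2 * t ^ 2 ≤ 1 := by
    rw [← mul_pow, sinc_mul_self]; exact Real.sin_sq_le_one t
  linarith

lemma integrable_sinc_sq : Integrable fun t => Real.sinc t ^ 2 := by
  refine (integrable_inv_one_add_sq.const_mul 2).mono'
    (Real.continuous_sinc.pow 2).aestronglyMeasurable (Filter.Eventually.of_forall fun t => ?_)
  rw [Real.norm_of_nonneg (by positivity), ← div_eq_mul_inv, le_div_iff₀ (by positivity)]
  exact sinc_sq_mul_one_add_sq_le t

lemma integrable_sinc_pow_four : Integrable fun t => Real.sinc t ^ 4 := by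
  refine integrable_sinc_sq.mono' (Real.continuous_sinc.pow 4).aestronglyMeasurable
    (Filter.Eventually.of_forall fun t => ?_)
  rw [Real.norm_of_nonneg (by positivity), show Real.sinc t ^ 4 = Real.sinc t ^ 2 * Real.sinc t ^ 2
    by ring]
  exact mul_le_of_le_one_left (by positivity)
    ((sq_le_one_iff_abs_le_one _).2 (Real.abs_sinc_le_one t))

lemma integral_sinc_pow_four_pos : 0 < ∫ t, Real.sinc t ^ 4 := by
  refine integral_pos_of_integrable_nonneg_nonzero (x := 0) (Real.continuous_sinc.pow 4)
    integrable_sinc_pow_four (fun t => by positivity) (by simp)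

/-- Two of the four factors `sinc s` pay for the decay `(1 + t ^ 2)⁻¹`; the other two keep the
integral finite. This is why the density is `sinc ^ 4`: a `sinc ^ 2` density would have tails of
order `1 / t`, which are not integrable. -/
lemma setIntegral_sinc_pow_four_le {S : Set ℝ} (hS : MeasurableSet S) (t : ℝ)
    (h : ∀ s ∈ S, t ^ 2 ≤ s ^ 2) :
    ∫ s in S, Real.sinc s ^ 4 ≤ 2 * (∫ s, Real.sinc s ^ 2) * (1 + t ^ 2)⁻¹ := by
  rw [← div_eq_mul_inv, le_div_iff₀ (by positivity), ← integral_mul_const, ← integral_const_mul]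
  calc _ ≤ ∫ s in S, 2 * Real.sinc s ^ 2 := by
        refine setIntegral_mono_on (integrable_sinc_pow_four.mul_const _).integrableOn
          (integrable_sinc_sq.const_mul 2).integrableOn hS fun s hs => ?_
        have h1 := sinc_sq_mul_one_add_sq_le s
        calc Real.sinc s ^ 4 * (1 + t ^ 2) ≤ Real.sinc s ^ 4 * (1 + s ^ 2) :=
              mul_le_mul_of_nonneg_left (by linarith [h s hs]) (by positivity)
          _ = Real.sinc s ^ 2 * (1 + s ^ 2) * Real.sinc s ^ 2 := by ring
          _ ≤ _ := by gcongr
    _ ≤ _ := setIntegral_le_integral (integrable_sinc_sq.const_mul 2)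
        (Filter.Eventually.of_forall fun t => by positivity)

lemma integrable_sincSqSum : Integrable sincSqSum :=
  integrable_sinc_sq.add (integrable_sinc_sq.comp_sub_right (Real.pi / 2))

/-- The distribution function of the probability density proportional to `sinc ^ 4`. -/
noncomputable def sincCdf (t : ℝ) : ℝ :=
  (∫ s, Real.sinc s ^ 4)⁻¹ * ∫ s in Set.Iic t, Real.sinc s ^ 4

lemma sincCdf_nonneg (t : ℝ) : 0 ≤ sincCdf t :=
  mul_nonneg (inv_nonneg.2 integral_sinc_pow_four_pos.le)
    (integral_nonneg fun t => by positivity)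

lemma one_sub_sincCdf (t : ℝ) :
    1 - sincCdf t = (∫ s, Real.sinc s ^ 4)⁻¹ * ∫ s in Set.Ioi t, Real.sinc s ^ 4 := by
  have h := intervalIntegral.integral_Iic_add_Ioi (b := t) integrable_sinc_pow_four.integrableOn
    integrable_sinc_pow_four.integrableOn
  have h0 := integral_sinc_pow_four_pos.ne'
  rw [sincCdf, sub_eq_iff_eq_add, ← mul_add, add_comm, h, inv_mul_cancel₀ h0]

lemma sincCdf_le_one (t : ℝ) : sincCdf t ≤ 1 := by
  rw [← sub_nonneg, one_sub_sincCdf]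
  exact mul_nonneg (inv_nonneg.2 integral_sinc_pow_four_pos.le)
    (integral_nonneg fun t => by positivity)

lemma hasDerivAt_sincCdf (t : ℝ) :
    HasDerivAt sincCdf ((∫ s, Real.sinc s ^ 4)⁻¹ * Real.sinc t ^ 4) t := by
  have h : sincCdf = fun t => (∫ s, Real.sinc s ^ 4)⁻¹ *
      ((∫ s in (0 : ℝ)..t, Real.sinc s ^ 4) + ∫ s in Set.Iic 0, Real.sinc s ^ 4) := by
    ext t
    rw [sincCdf, ← intervalIntegral.integral_Iic_sub_Iic integrable_sinc_pow_four.integrableOn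
      integrable_sinc_pow_four.integrableOn, sub_add_cancel]
  rw [h]
  have hc := Real.continuous_sinc.pow 4
  exact ((intervalIntegral.integral_hasDerivAt_right (hc.intervalIntegrable _ _)
    (hc.stronglyMeasurableAtFilter _ _) hc.continuousAt).add_const _).const_mul _

lemma exists_derivBound_sincCdf : ∃ D : ℝ, 2 ≤ D ∧ DerivBound sincCdf D := by
  refine ⟨max 4 |(∫ s, Real.sinc s ^ 4)⁻¹|, le_max_of_le_left (by norm_num),
    DerivBound.of_deriv hasDerivAt_sincCdf (fun x => ?_) (derivBound_sinc.pow 4) ?_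
      (le_max_right _ _)⟩
  · rw [abs_of_nonneg (sincCdf_nonneg x)]; exact sincCdf_le_one x
  · simp

/-- The error is a tail of the `sinc ^ 4` density: the right tail for `t > 0`, the left tail
otherwise. Every point of that tail is at least `|t|` away from the origin. -/
lemma exists_abs_indicator_sub_sincCdf_le : ∃ K : ℝ, 0 ≤ K ∧ ∀ t : ℝ,
    |(if 0 < t then 1 else 0) - sincCdf t| ≤ K * sincSqSum t := by
  have hI := integral_sinc_pow_four_pos
  have hJ : 0 ≤ ∫ s, Real.sinc s ^ 2 := integral_nonneg fun t => by positivity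
  refine ⟨(∫ s, Real.sinc s ^ 4)⁻¹ * (2 * (∫ s, Real.sinc s ^ 2)) * 5, by positivity,
    fun t => ?_⟩
  have key : ∀ S : Set ℝ, MeasurableSet S → (∀ s ∈ S, t ^ 2 ≤ s ^ 2) →
      (∫ s, Real.sinc s ^ 4)⁻¹ * ∫ s in S, Real.sinc s ^ 4 ≤
        (∫ s, Real.sinc s ^ 4)⁻¹ * (2 * (∫ s, Real.sinc s ^ 2)) * 5 * sincSqSum t := by
    intro S hS h
    rw [mul_assoc _ 5, mul_assoc]
    gcongr
    exact (setIntegral_sinc_pow_four_le hS t h).trans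
      (by gcongr; exact inv_one_add_sq_le_sincSqSum t)
  split_ifs with ht
  · rw [abs_of_nonneg (sub_nonneg.2 (sincCdf_le_one t)), one_sub_sincCdf]
    exact key _ measurableSet_Ioi fun s hs => by
      have : t < s := hs
      gcongr
  · rw [zero_sub, abs_neg, abs_of_nonneg (sincCdf_nonneg t)]
    refine key _ measurableSet_Iic fun s hs => ?_
    have : s ≤ t := hs
    push Not at ht
    nlinarith

/-! ### Polynomial approximation of products and matching moments -/

/-- All polynomials of total degree at most `k` are integrable and have the same integrals
with respect to `μ` and `ν`. -/
structure MomentsMatch {ι : Type*} (k : ℕ) (μ ν : Measure (ι → ℝ)) : Prop where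
  integrable_left : ∀ q : MvPolynomial ι ℝ, q.totalDegree ≤ k →
    Integrable (fun x => MvPolynomial.eval x q) μ
  integrable_right : ∀ q : MvPolynomial ι ℝ, q.totalDegree ≤ k →
    Integrable (fun x => MvPolynomial.eval x q) ν
  integral_eq : ∀ q : MvPolynomial ι ℝ, q.totalDegree ≤ k →
    ∫ x, MvPolynomial.eval x q ∂μ = ∫ x, MvPolynomial.eval x q ∂ν

section

variable {ι : Type*}

/-- Restricting to the ray `t ↦ t • x` reduces multivariate Taylor expansion to one variable: each
derivative of a factor in `t` brings out one power of its coordinate. -/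
lemma exists_eval_eq_iteratedDeriv_prod (s : Finset ι) {h : ι → ℝ → ℝ} {A : ℝ}
    (hh : ∀ i ∈ s, DerivBound (h i) A) (j : ℕ) :
    ∃ q : MvPolynomial ι ℝ, q.totalDegree ≤ j ∧ ∀ x : ι → ℝ,
      iteratedDeriv j (fun t => ∏ i ∈ s, h i (x i * t)) 0 = MvPolynomial.eval x q := by
  classical
  induction s using Finset.induction_on generalizing j with
  | empty =>
    refine ⟨if j = 0 then 1 else 0, by split_ifs <;> simp, fun x => ?_⟩
    simp only [Finset.prod_empty, iteratedDeriv_const]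
    split_ifs <;> simp
  | insert a s ha ih =>
    have hs : ∀ i ∈ s, DerivBound (h i) A := fun i hi => hh i (by simp [hi])
    choose q hq hqx using ih hs
    refine ⟨∑ i ∈ Finset.range (j + 1), MvPolynomial.C (j.choose i * iteratedDeriv i (h a) 0) *
      MvPolynomial.X a ^ i * q (j - i), ?_, fun x => ?_⟩
    · refine MvPolynomial.totalDegree_finsetSum_le fun i hi => ?_
      have hij : i ≤ j := Nat.lt_succ_iff.1 (Finset.mem_range.1 hi)
      refine (MvPolynomial.totalDegree_mul _ _).trans ?_
      have h1 : (MvPolynomial.C (j.choose i * iteratedDeriv i (h a) 0) *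
          MvPolynomial.X a ^ i : MvPolynomial ι ℝ).totalDegree ≤ i := by
        refine (MvPolynomial.totalDegree_mul _ _).trans ?_
        rw [MvPolynomial.totalDegree_C, MvPolynomial.totalDegree_X_pow, zero_add]
      have := hq (j - i)
      omega
    · simp only [Finset.prod_insert ha]
      have hp := DerivBound.prod s (f := fun i t => h i (x i * t)) (A := fun i => A * |x i|)
        fun i hi => (hs i hi).comp_mul_const _
      have ha' := hh a (by simp)
      rw [iteratedDeriv_fun_mul ((ha'.comp_mul_const (x a)).contDiff j).contDiffAt
        (hp.contDiff j).contDiffAt, map_sum]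
      refine Finset.sum_congr rfl fun i _ => ?_
      rw [hqx, iteratedDeriv_comp_const_mul (ha'.contDiff i)]
      simp only [mul_zero, map_mul, MvPolynomial.eval_C, map_pow, MvPolynomial.eval_X]
      ring

lemma exists_abs_prod_sub_eval_le (s : Finset ι) {h : ι → ℝ → ℝ} {A : ℝ}
    (hh : ∀ i ∈ s, DerivBound (h i) A) {k : ℕ} (hk : k ≠ 0) :
    ∃ q : MvPolynomial ι ℝ, q.totalDegree ≤ k ∧ ∀ x : ι → ℝ,
      |∏ i ∈ s, h i (x i) - MvPolynomial.eval x q| ≤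
        (A * ∑ i ∈ s, |x i|) ^ k / k.factorial := by
  choose q hq hqx using exists_eval_eq_iteratedDeriv_prod s hh
  refine ⟨∑ j ∈ Finset.range k, MvPolynomial.C ((j.factorial : ℝ)⁻¹) * q j, ?_, fun x => ?_⟩
  · refine MvPolynomial.totalDegree_finsetSum_le fun j hj => ?_
    refine (MvPolynomial.totalDegree_mul _ _).trans ?_
    have := hq j
    have := Finset.mem_range.1 hj
    simp only [MvPolynomial.totalDegree_C]
    omega
  · have hp := DerivBound.prod s (f := fun i t => h i (x i * t)) (A := fun i => A * |x i|)
      fun i hi => (hh i hi).comp_mul_const _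
    have := hp.abs_sub_taylor_le k hk
    rw [← Finset.mul_sum] at this
    simpa [hqx, div_eq_inv_mul] using this

lemma sum_abs_pow_le (s : Finset ι) (x : ι → ℝ) {k : ℕ} (hk : k ≠ 0) (hke : Even k) :
    (∑ i ∈ s, |x i|) ^ k ≤ (s.card : ℝ) ^ (k - 1) * ∑ i ∈ s, x i ^ k := by
  obtain ⟨n, rfl⟩ := Nat.exists_eq_succ_of_ne_zero hk
  rcases s.eq_empty_or_nonempty with rfl | hs
  · simp
  have hc : (0 : ℝ) < s.card := by exact_mod_cast hs.card_pos
  have := pow_sum_div_card_le_sum_pow (s := s) (f := fun i => |x i|) (fun i _ => abs_nonneg _) n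
  rw [div_le_iff₀ (by positivity)] at this
  simpa [hke.pow_abs, mul_comm] using this

/-- Products of functions with bounded derivatives have nearly the same expectation with respect
to two measures with the same moments up to order `k`. -/
lemma MomentsMatch.abs_integral_prod_sub_le {k : ℕ} {μ ν : Measure (ι → ℝ)}
    [IsProbabilityMeasure μ] [IsProbabilityMeasure ν] (hμν : MomentsMatch k μ ν)
    (hk : k ≠ 0) (hke : Even k) {M : ℝ} (s : Finset ι) (hM : ∀ i ∈ s, ∫ x, x i ^ k ∂μ ≤ M)
    {h : ι → ℝ → ℝ} {A : ℝ} (hA : 0 ≤ A) (hh : ∀ i ∈ s, DerivBound (h i) A) :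
    |∫ x, ∏ i ∈ s, h i (x i) ∂μ - ∫ x, ∏ i ∈ s, h i (x i) ∂ν| ≤
      2 * ((A * s.card) ^ k * (M / k.factorial)) := by
  obtain ⟨q, hq, hqx⟩ := exists_abs_prod_sub_eval_le s hh hk
  -- The Taylor remainder is dominated by a polynomial of degree at most `k`, using the power mean
  -- inequality and the evenness of `k` to remove absolute values. Its integral is therefore the
  -- same for both measures, and only a moment bound for `μ` is needed.
  set r : MvPolynomial ι ℝ := MvPolynomial.C (A ^ k / k.factorial * (s.card : ℝ) ^ (k - 1)) *
    ∑ i ∈ s, MvPolynomial.X i ^ k with hr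
  have hrx : ∀ x, MvPolynomial.eval x r =
      A ^ k / k.factorial * (s.card : ℝ) ^ (k - 1) * ∑ i ∈ s, x i ^ k := by
    intro x; simp [hr]
  have hrd : r.totalDegree ≤ k := by
    refine (MvPolynomial.totalDegree_mul _ _).trans ?_
    simp only [MvPolynomial.totalDegree_C, zero_add]
    exact MvPolynomial.totalDegree_finsetSum_le fun i _ => by simp [MvPolynomial.totalDegree_X_pow]
  have hle : ∀ x, ‖∏ i ∈ s, h i (x i) - MvPolynomial.eval x q‖ ≤ MvPolynomial.eval x r := by
    intro x
    rw [hrx]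
    refine (hqx x).trans ?_
    rw [mul_pow, mul_div_right_comm, mul_assoc]
    gcongr
    exact sum_abs_pow_le s x hk hke
  have hxk : ∀ i, Integrable (fun x : ι → ℝ => x i ^ k) μ := fun i => by
    simpa using hμν.integrable_left (MvPolynomial.X i ^ k)
      (by simp [MvPolynomial.totalDegree_X_pow])
  have hrμ : ∫ x, MvPolynomial.eval x r ∂μ ≤ (A * s.card) ^ k * (M / k.factorial) := by
    simp only [hrx]
    rw [integral_const_mul, integral_finsetSum _ fun i _ => hxk i]
    calc _ ≤ A ^ k / k.factorial * (s.card : ℝ) ^ (k - 1) * ∑ i ∈ s, M := by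
          gcongr with i hi; exact hM i hi
      _ = _ := by
          obtain ⟨n, rfl⟩ := Nat.exists_eq_succ_of_ne_zero hk
          rw [Finset.sum_const, nsmul_eq_mul, mul_pow]
          simp only [Nat.succ_eq_add_one, Nat.add_sub_cancel]
          ring
  have hf : ∀ (ρ : Measure (ι → ℝ)) [IsProbabilityMeasure ρ],
      Integrable (fun x => ∏ i ∈ s, h i (x i)) ρ := by
    intro ρ _
    refine Integrable.of_bound (C := 1) (Measurable.aestronglyMeasurable ?_)
      (Filter.Eventually.of_forall fun x => ?_)
    · exact Finset.measurable_prod _ fun i hi =>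
        (hh i hi).continuous.measurable.comp (measurable_pi_apply i)
    · rw [Real.norm_eq_abs, Finset.abs_prod]
      exact Finset.prod_le_one (fun i _ => abs_nonneg _) fun i hi => (hh i hi).abs_le_one _
  have h1 : |∫ x, ∏ i ∈ s, h i (x i) ∂μ - ∫ x, MvPolynomial.eval x q ∂μ| ≤
      ∫ x, MvPolynomial.eval x r ∂μ := by
    rw [← integral_sub (hf μ) (hμν.integrable_left q hq)]
    exact norm_integral_le_of_norm_le (hμν.integrable_left r hrd) (Filter.Eventually.of_forall hle)
  have h2 : |∫ x, ∏ i ∈ s, h i (x i) ∂ν - ∫ x, MvPolynomial.eval x q ∂ν| ≤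
      ∫ x, MvPolynomial.eval x r ∂ν := by
    rw [← integral_sub (hf ν) (hμν.integrable_right q hq)]
    exact norm_integral_le_of_norm_le (hμν.integrable_right r hrd)
      (Filter.Eventually.of_forall hle)
  rw [← hμν.integral_eq q hq, ← hμν.integral_eq r hrd] at h2
  rw [abs_le] at h1 h2 ⊢
  constructor <;> linarith [h1.1, h1.2, h2.1, h2.2]

end

/-! ### Gaussian moments and smoothing errors -/

/-- `y ^ k / k! ≤ exp |y|` at `y = √k * x` reduces the moment to the Gaussian moment generating
function at `±√k`, which equals `exp (k / 2)`. -/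
lemma integral_pow_gaussianReal_le {k : ℕ} (hk : Even k) :
    √(k : ℝ) ^ k * ((∫ x, x ^ k ∂gaussianReal 0 1) / k.factorial) ≤ 2 * 2 ^ k := by
  have hint : ∀ t : ℝ, ∫ x, Real.exp (t * x) ∂gaussianReal 0 1 = Real.exp (t ^ 2 / 2) := by
    intro t
    have := congrFun (mgf_fun_id_gaussianReal (μ := 0) (v := 1)) t
    simpa [mgf] using this
  rw [← integral_div, ← integral_const_mul]
  calc _ ≤ ∫ x, (Real.exp (√(k : ℝ) * x) + Real.exp (-√(k : ℝ) * x)) ∂gaussianReal 0 1 := by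
        refine integral_mono_of_nonneg (Filter.Eventually.of_forall fun x => ?_)
          ((integrable_exp_mul_gaussianReal _).add (integrable_exp_mul_gaussianReal _))
          (Filter.Eventually.of_forall fun x => ?_)
        · have := hk.pow_nonneg x
          dsimp only [Pi.zero_apply]; positivity
        · have h := Real.pow_div_factorial_le_exp (x := |√(k : ℝ) * x|) (abs_nonneg _) k
          rw [hk.pow_abs, mul_pow, mul_div_assoc] at h
          refine h.trans ((Real.exp_abs_le _).trans_eq ?_)
          simp
    _ = 2 * Real.exp (1 / 2) ^ k := by
        rw [integral_add (integrable_exp_mul_gaussianReal _) (integrable_exp_mul_gaussianReal _),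
          hint, hint, neg_sq, Real.sq_sqrt (Nat.cast_nonneg k), ← Real.exp_nat_mul]
        ring_nf
    _ ≤ _ := by
        gcongr
        -- Squaring turns `exp (1 / 2) ≤ 2` into `e ≤ 4`.
        rw [← abs_of_pos (Real.exp_pos (1 / 2)), ← abs_of_pos (zero_lt_two (α := ℝ)), ← sq_le_sq,
          ← Real.exp_nat_mul]
        norm_num
        linarith [Real.exp_one_lt_d9]

lemma continuous_sincSqSum : Continuous sincSqSum :=
  (Real.continuous_sinc.pow 2).add ((Real.continuous_sinc.comp (by fun_prop)).pow 2)

lemma abs_prod_sub_prod_le {ι : Type*} (s : Finset ι) (a b : ι → ℝ)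
    (ha : ∀ i ∈ s, |a i| ≤ 1) (hb : ∀ i ∈ s, |b i| ≤ 1) :
    |∏ i ∈ s, a i - ∏ i ∈ s, b i| ≤ ∑ i ∈ s, |a i - b i| := by
  classical
  induction s using Finset.induction_on with
  | empty => simp
  | insert j s hj ih =>
    rw [Finset.prod_insert hj, Finset.prod_insert hj, Finset.sum_insert hj]
    have ih := ih (fun i hi => ha i (by simp [hi])) (fun i hi => hb i (by simp [hi]))
    have hp : |∏ i ∈ s, a i| ≤ 1 := by
      rw [Finset.abs_prod]
      exact Finset.prod_le_one (fun i _ => abs_nonneg _) fun i hi => ha i (by simp [hi])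
    calc |a j * ∏ i ∈ s, a i - b j * ∏ i ∈ s, b i|
        = |(a j - b j) * ∏ i ∈ s, a i + b j * (∏ i ∈ s, a i - ∏ i ∈ s, b i)| := by ring_nf
      _ ≤ |a j - b j| * |∏ i ∈ s, a i| + |b j| * |∏ i ∈ s, a i - ∏ i ∈ s, b i| := by
          rw [← abs_mul, ← abs_mul]; exact abs_add_le _ _
      _ ≤ |a j - b j| * 1 + 1 * ∑ i ∈ s, |a i - b i| := by
          gcongr
          exact hb j (by simp)
      _ = _ := by ring

/-- Anticoncentration: the Gaussian density is at most `1`, so the Lebesgue integral is an upper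
bound, and it scales like `1 / c` whatever `θ` is. -/
lemma integral_sincSqSum_gaussianReal_le {c : ℝ} (hc : 0 < c) (θ : ℝ) :
    ∫ t, sincSqSum (c * (t - θ)) ∂gaussianReal 0 1 ≤ (∫ t, sincSqSum t) / c := by
  rw [integral_gaussianReal_eq_integral_smul one_ne_zero]
  have hint : Integrable fun t => sincSqSum (c * (t - θ)) :=
    (integrable_sincSqSum.comp_mul_left' hc.ne').comp_sub_right θ
  calc _ ≤ ∫ t, sincSqSum (c * (t - θ)) := by
        refine integral_mono_of_nonneg (Filter.Eventually.of_forall fun t => ?_) hint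
          (Filter.Eventually.of_forall fun t => ?_)
        · exact mul_nonneg (gaussianPDFReal_nonneg _ _ _) (sincSqSum_nonneg _)
        · refine mul_le_of_le_one_left (sincSqSum_nonneg _) ?_
          rw [gaussianPDFReal_def]
          refine mul_le_one₀ (inv_le_one_of_one_le₀ ?_) (Real.exp_pos _).le
            (Real.exp_le_one_iff.2 ?_)
          · rw [Real.one_le_sqrt]
            have := Real.pi_gt_three
            push_cast
            linarith
          · rw [neg_div, neg_nonpos]
            positivity
    _ = _ := by
        rw [integral_sub_right_eq_self (fun t => sincSqSum (c * t)) θ,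
          Measure.integral_comp_mul_left, abs_of_pos (inv_pos.2 hc), smul_eq_mul, inv_mul_eq_div]

/-! ### Comparing orthant probabilities -/

section

variable {ι : Type*} [Fintype ι]

lemma integrable_sincSqSum_comp (ρ : Measure (ι → ℝ)) [IsProbabilityMeasure ρ] (c θ : ℝ) (i : ι) :
    Integrable (fun x => sincSqSum (c * (x i - θ))) ρ := by
  refine Integrable.of_bound (C := 2) ?_ (Filter.Eventually.of_forall fun x => ?_)
  · exact (continuous_sincSqSum.comp (by fun_prop)).aestronglyMeasurable
  · rw [Real.norm_of_nonneg (sincSqSum_nonneg _)]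
    have h := fun t => (sq_le_one_iff_abs_le_one _).2 (Real.abs_sinc_le_one t)
    rw [sincSqSum]
    linarith [h (c * (x i - θ)), h (c * (x i - θ) - Real.pi / 2)]

/-- The orthant indicator is a product of step functions; exchanging factors one at a time costs at
most the sum of the one-dimensional errors, since all factors lie in `[-1, 1]`. -/
lemma abs_measureReal_sub_integral_prod_sincCdf_le {K : ℝ}
    (hK : ∀ t : ℝ, |(if 0 < t then 1 else 0) - sincCdf t| ≤ K * sincSqSum t)
    (ρ : Measure (ι → ℝ)) [IsProbabilityMeasure ρ] {c : ℝ} (hc : 0 < c) (θ : ι → ℝ) :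
    |ρ.real {x | ∀ i, θ i < x i} - ∫ x, ∏ i, sincCdf (c * (x i - θ i)) ∂ρ| ≤
      K * ∑ i, ∫ x, sincSqSum (c * (x i - θ i)) ∂ρ := by
  obtain ⟨D, -, hD⟩ := exists_derivBound_sincCdf
  have hS : MeasurableSet {x : ι → ℝ | ∀ i, θ i < x i} := by
    rw [Set.ofPred_forall]
    exact MeasurableSet.iInter fun i => measurableSet_lt measurable_const (measurable_pi_apply i)
  have hind : ∀ x : ι → ℝ, Set.indicator {x : ι → ℝ | ∀ i, θ i < x i} 1 x =
      ∏ i, (if 0 < c * (x i - θ i) then (1 : ℝ) else 0) := by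
    intro x
    have h : ∀ i, 0 < c * (x i - θ i) ↔ θ i < x i := fun i => by
      rw [mul_pos_iff_of_pos_left hc, sub_pos]
    simp only [h, Set.indicator_apply, Set.mem_ofPred_eq, Pi.one_apply]
    split_ifs with hx
    · exact (Finset.prod_eq_one fun i _ => by simp [hx i]).symm
    · push Not at hx
      obtain ⟨i, hi⟩ := hx
      exact (Finset.prod_eq_zero (Finset.mem_univ i) (by simp [hi])).symm
  have hf : Integrable (fun x : ι → ℝ => ∏ i, sincCdf (c * (x i - θ i))) ρ := by
    refine Integrable.of_bound (C := 1) (Continuous.aestronglyMeasurable ?_)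
      (Filter.Eventually.of_forall fun x => ?_)
    · exact continuous_finsetProd _ fun i _ => hD.continuous.comp (by fun_prop)
    · rw [Real.norm_eq_abs, Finset.abs_prod]
      exact Finset.prod_le_one (fun i _ => abs_nonneg _) fun i _ => hD.abs_le_one _
  have hψ := fun i => integrable_sincSqSum_comp ρ c (θ i) i
  have h1 : Integrable (Set.indicator {x : ι → ℝ | ∀ i, θ i < x i} (1 : (ι → ℝ) → ℝ)) ρ :=
    (integrable_const (1 : ℝ)).indicator hS
  rw [← integral_indicator_one hS, ← integral_sub h1 hf,
    ← integral_finsetSum _ fun i _ => hψ i, ← integral_const_mul,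
    ← Real.norm_eq_abs]
  refine norm_integral_le_of_norm_le ((integrable_finsetSum _ fun i _ => hψ i).const_mul K)
    (Filter.Eventually.of_forall fun x => ?_)
  rw [hind, Finset.mul_sum, Real.norm_eq_abs]
  refine (abs_prod_sub_prod_le _ _ _ (fun i _ => ?_) fun i _ => hD.abs_le_one _).trans
    (Finset.sum_le_sum fun i _ => hK _)
  split_ifs <;> simp

/-- If products of functions with derivative bounds have nearly the same expectation with respect
to `μ` and `ν`, and `μ` is anticoncentrated, then `μ` and `ν` nearly agree on orthants. -/
lemma abs_measureReal_orthant_sub_le {D K : ℝ} (hD2 : 2 ≤ D) (hD : DerivBound sincCdf D)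
    (hK0 : 0 ≤ K) (hK : ∀ t : ℝ, |(if 0 < t then 1 else 0) - sincCdf t| ≤ K * sincSqSum t)
    {μ ν : Measure (ι → ℝ)} [IsProbabilityMeasure μ] [IsProbabilityMeasure ν]
    {c T E : ℝ} (hc : 0 < c) (θ : ι → ℝ)
    (hT : ∀ (s : Finset ι) (h : ι → ℝ → ℝ), (∀ i ∈ s, DerivBound (h i) (D * c)) →
      |∫ x, ∏ i ∈ s, h i (x i) ∂μ - ∫ x, ∏ i ∈ s, h i (x i) ∂ν| ≤ T)
    (hE : ∀ i, ∫ x, sincSqSum (c * (x i - θ i)) ∂μ ≤ E) :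
    |μ.real {x | ∀ i, θ i < x i} - ν.real {x | ∀ i, θ i < x i}| ≤
      T + K * Fintype.card ι * (2 * E + 2 * T) := by
  have hsq : ∀ b : ℝ, DerivBound (fun t => Real.sinc (c * t - b) ^ 2) (D * c) := fun b => by
    refine (((derivBound_sinc.pow 2).comp_sub_const b).comp_mul_const c).mono ?_
    rw [abs_of_pos hc]
    gcongr
    simpa using hD2
  -- Anticoncentration passes from `μ` to `ν`: `hT` applies to each of the two squares in
  -- `sincSqSum` as a one-factor product, at a cost of `T` each.
  have hν : ∀ i, ∫ x, sincSqSum (c * (x i - θ i)) ∂ν ≤ E + 2 * T := by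
    intro i
    have hsplit : ∀ (ρ : Measure (ι → ℝ)) [IsProbabilityMeasure ρ],
        ∫ x, sincSqSum (c * (x i - θ i)) ∂ρ =
          ∫ x, Real.sinc (c * (x i - θ i) - 0) ^ 2 ∂ρ +
          ∫ x, Real.sinc (c * (x i - θ i) - Real.pi / 2) ^ 2 ∂ρ := by
      intro ρ _
      have hint : ∀ b : ℝ, Integrable (fun x : ι → ℝ => Real.sinc (c * (x i - θ i) - b) ^ 2) ρ := by
        intro b
        refine Integrable.of_bound (C := 1) (Continuous.aestronglyMeasurable ?_)
          (Filter.Eventually.of_forall fun x => ((hsq b).comp_sub_const (θ i)).abs_le_one (x i))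
        exact ((hsq b).comp_sub_const (θ i)).continuous.comp (continuous_apply i)
      rw [← integral_add (hint _) (hint _)]
      simp [sincSqSum]
    have h1 := fun b => hT {i} (fun i t => Real.sinc (c * (t - θ i) - b) ^ 2)
      fun j _ => (hsq b).comp_sub_const (θ j)
    simp only [Finset.prod_singleton] at h1
    have h2 := hE i
    rw [hsplit] at h2 ⊢
    linarith [(abs_le.1 (h1 0)).1, (abs_le.1 (h1 (Real.pi / 2))).1]
  have h0 := hT Finset.univ (fun i t => sincCdf (c * (t - θ i))) fun i _ => by
    simpa [abs_of_pos hc] using (hD.comp_mul_const c).comp_sub_const (θ i)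
  have hμ := abs_measureReal_sub_integral_prod_sincCdf_le hK μ hc θ
  have hν' := abs_measureReal_sub_integral_prod_sincCdf_le hK ν hc θ
  have s1 : K * ∑ i, ∫ x, sincSqSum (c * (x i - θ i)) ∂μ ≤ K * (Fintype.card ι * E) := by
    gcongr
    simpa using Finset.sum_le_card_nsmul Finset.univ _ E fun i _ => hE i
  have s2 : K * ∑ i, ∫ x, sincSqSum (c * (x i - θ i)) ∂ν ≤
      K * (Fintype.card ι * (E + 2 * T)) := by
    gcongr
    exact (Finset.sum_le_card_nsmul Finset.univ _ (E + 2 * T) fun i _ => hν i).trans_eq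
      (by rw [nsmul_eq_mul, Finset.card_univ])
  rw [abs_le] at h0 hμ hν' ⊢
  constructor <;> nlinarith [h0.1, h0.2, hμ.1, hμ.2, hν'.1, hν'.2]

/-- Measures with the same moments up to an order `k ≥ C m ^ 4 / ε ^ 2` as a measure with standard
normal marginals nearly agree with it on orthants. -/
theorem exists_abs_measureReal_orthant_sub_lt :
    ∃ C : ℝ, 0 < C ∧ ∀ (m k : ℕ) (ε : ℝ), 0 < m → 0 < ε → Even k →
      C * (m : ℝ) ^ 4 / ε ^ 2 ≤ (k : ℝ) →
      ∀ (μ ν : Measure (Fin m → ℝ)) [IsProbabilityMeasure μ] [IsProbabilityMeasure ν],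
      MomentsMatch k μ ν → (∀ i, μ.map (fun x => x i) = gaussianReal 0 1) →
      ∀ θ : Fin m → ℝ,
        |μ.real {x | ∀ i, θ i < x i} - ν.real {x | ∀ i, θ i < x i}| < ε := by
  obtain ⟨D, hD2, hD⟩ := exists_derivBound_sincCdf
  obtain ⟨K, hK0, hK⟩ := exists_abs_indicator_sub_sincCdf_le
  set J := ∫ t, sincSqSum t with hJ
  have hJ0 : 0 ≤ J := integral_nonneg sincSqSum_nonneg
  -- With `T = 4 / √k` and `E = J / c = 4 * D * J * m / √k`, the bound `T + K * m * (2 * E + 2 * T)`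
  -- equals `(4 + 8 * K * m + 8 * K * J * D * m ^ 2) / √k`, hence is at most `L * m ^ 2 / √k`.
  -- Taking `(L + 1) ^ 2` as the constant makes the final inequality strict.
  set L := 4 + 8 * K + 8 * K * J * D with hL
  have hL0 : 0 < L := by positivity
  refine ⟨(L + 1) ^ 2, by positivity, ?_⟩
  intro m k ε hm hε hke hk μ ν _ _ hμν hμ θ
  have hm1 : (1 : ℝ) ≤ m := by exact_mod_cast hm
  have hk0 : k ≠ 0 := by
    rintro rfl
    have : 0 < (L + 1) ^ 2 * (m : ℝ) ^ 4 / ε ^ 2 := by positivity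
    simp only [Nat.cast_zero] at hk
    linarith
  have hkpos : (0 : ℝ) < k := by exact_mod_cast Nat.pos_of_ne_zero hk0
  have hs : 0 < √(k : ℝ) := Real.sqrt_pos.2 hkpos
  have hsε : (L + 1) * (m : ℝ) ^ 2 / √(k : ℝ) ≤ ε := by
    rw [div_le_iff₀ (by positivity)] at hk ⊢
    refine (sq_le_sq₀ (by positivity) (by positivity)).1 ?_
    rw [mul_pow ε, Real.sq_sqrt hkpos.le]
    nlinarith
  -- Chosen so that `D * c * m = √k / 4`: the factor `4 ^ k` in the denominator beats the `2 ^ k` of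
  -- the Gaussian moment bound.
  set c := √(k : ℝ) / (4 * D * m) with hc
  have hc0 : 0 < c := by positivity
  set M := ∫ x, x ^ k ∂gaussianReal 0 1 with hM
  have hmap : ∀ (i : Fin m) (f : ℝ → ℝ), Continuous f → ∫ x, f (x i) ∂μ =
      ∫ t, f t ∂gaussianReal 0 1 := by
    intro i f hf
    rw [← hμ i, integral_map (measurable_pi_apply i).aemeasurable hf.aestronglyMeasurable]
  have hMle := integral_pow_gaussianReal_le hke
  have hM0 : 0 ≤ M := integral_nonneg fun x => hke.pow_nonneg x
  have hT : ∀ (s : Finset (Fin m)) (h : Fin m → ℝ → ℝ), (∀ i ∈ s, DerivBound (h i) (D * c)) →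
      |∫ x, ∏ i ∈ s, h i (x i) ∂μ - ∫ x, ∏ i ∈ s, h i (x i) ∂ν| ≤ 4 / √(k : ℝ) := by
    intro s h hh
    refine (hμν.abs_integral_prod_sub_le hk0 hke (M := M) s
      (fun i _ => (hmap i _ (continuous_pow k)).le) (by positivity) hh).trans ?_
    have hcard : (s.card : ℝ) ≤ m := by
      exact_mod_cast (Finset.card_le_univ s).trans_eq (Fintype.card_fin m)
    have hDc : D * c * m = √(k : ℝ) / 4 := by rw [hc]; field_simp
    have h2k : √(k : ℝ) ≤ 2 ^ k := by
      have h1 : (1 : ℝ) ≤ k := by exact_mod_cast Nat.pos_of_ne_zero hk0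
      refine (Real.sqrt_le_iff.2 ⟨hkpos.le, by nlinarith⟩ : √(k : ℝ) ≤ k).trans ?_
      exact_mod_cast Nat.lt_two_pow_self.le
    calc 2 * ((D * c * s.card) ^ k * (M / k.factorial))
        ≤ 2 * ((D * c * m) ^ k * (M / k.factorial)) := by gcongr
      _ = 2 * (√(k : ℝ) ^ k * (M / k.factorial)) / 4 ^ k := by
          rw [hDc, div_pow]; ring
      _ ≤ 2 * (2 * 2 ^ k) / 4 ^ k := by gcongr
      _ = 4 / 2 ^ k := by
          rw [show (4 : ℝ) = 2 * 2 by norm_num, mul_pow]; field_simp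
      _ ≤ 4 / √(k : ℝ) := by gcongr
  have hE : ∀ i, ∫ x, sincSqSum (c * (x i - θ i)) ∂μ ≤ J / c := fun i => by
    rw [hmap i (fun t => sincSqSum (c * (t - θ i))) (continuous_sincSqSum.comp (by fun_prop))]
    exact integral_sincSqSum_gaussianReal_le hc0 (θ i)
  have h := abs_measureReal_orthant_sub_le hD2 hD hK0 hK hc0 θ hT hE
  refine (h.trans ?_).trans_lt
    ((div_lt_div_of_pos_right ?_ hs).trans_le hsε : L * (m : ℝ) ^ 2 / √(k : ℝ) < ε)
  · rw [Fintype.card_fin, hc, le_div_iff₀ hs]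
    field_simp
    rw [hL]
    have : (m : ℝ) ≤ m ^ 2 := by nlinarith
    nlinarith [mul_nonneg hK0 hJ0, mul_nonneg hK0 (sub_nonneg.2 this)]
  · have : 0 < (m : ℝ) ^ 2 := by positivity
    linarith

end

/-! ### Moments of `k`-wise independent normals -/

lemma integrable_pow_gaussianReal (n : ℕ) : Integrable (fun x => x ^ n) (gaussianReal 0 1) :=
  integrable_pow_of_integrable_exp_mul one_ne_zero (integrable_exp_mul_gaussianReal _)
    (integrable_exp_mul_gaussianReal _) n

lemma integrable_prod_pow_pi_gaussianReal {ι : Type*} [Fintype ι] (d : ι → ℕ) :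
    Integrable (fun x : ι → ℝ => ∏ i, x i ^ d i) (Measure.pi fun _ => gaussianReal 0 1) :=
  Integrable.fintype_prod fun i => integrable_pow_gaussianReal (d i)

namespace IsKWiseIndepStdNormals

variable {n k : ℕ} {Ω : Type*} [MeasurableSpace Ω] {Y : Ω → EuclideanSpace ℝ (Fin n)}
  {P : Measure Ω}

lemma hasLaw_restrict (hY : IsKWiseIndepStdNormals k Y P) {S : Finset (Fin n)} (hS : S.card ≤ k) :
    HasLaw (fun ω (i : S) => Y ω i) (Measure.pi fun _ => gaussianReal 0 1) P :=
  (hY.indep S hS).hasLaw_pi fun i => hY.hasLaw i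

lemma integrable_monomial (hY : IsKWiseIndepStdNormals k Y P) {d : Fin n →₀ ℕ}
    (hd : d.support.card ≤ k) : Integrable (fun ω => ∏ i ∈ d.support, Y ω i ^ d i) P := by
  have h := integrable_prod_pow_pi_gaussianReal fun i : d.support => d i
  rw [← (hY.hasLaw_restrict hd).map_eq] at h
  have := h.comp_aemeasurable (hY.hasLaw_restrict hd).aemeasurable
  refine this.congr (Filter.Eventually.of_forall fun ω => ?_)
  exact Finset.prod_coe_sort d.support fun i => Y ω i ^ d i

lemma integral_monomial (hY : IsKWiseIndepStdNormals k Y P) {d : Fin n →₀ ℕ}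
    (hd : d.support.card ≤ k) : ∫ ω, ∏ i ∈ d.support, Y ω i ^ d i ∂P =
      ∫ x : d.support → ℝ, ∏ i, x i ^ d i ∂Measure.pi fun _ => gaussianReal 0 1 := by
  rw [← (hY.hasLaw_restrict hd).integral_comp
    (integrable_prod_pow_pi_gaussianReal _).aestronglyMeasurable]
  congr 1 with ω
  exact (Finset.prod_coe_sort d.support fun i => Y ω i ^ d i).symm

/-- Each variable that occurs contributes at least one to the degree, so `k`-wise independence
determines the mean of every monomial of degree at most `k`. -/
lemma card_support_le {p : MvPolynomial (Fin n) ℝ} (hp : p.totalDegree ≤ k) {d : Fin n →₀ ℕ}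
    (hd : d ∈ p.support) : d.support.card ≤ k := by
  refine le_trans ?_ ((MvPolynomial.le_totalDegree hd).trans hp)
  simpa [Finsupp.sum] using Finset.card_nsmul_le_sum d.support d 1 fun i hi =>
    Nat.one_le_iff_ne_zero.2 (Finsupp.mem_support_iff.1 hi)

lemma integrable_eval (hY : IsKWiseIndepStdNormals k Y P) {p : MvPolynomial (Fin n) ℝ}
    (hp : p.totalDegree ≤ k) : Integrable (fun ω => MvPolynomial.eval (Y ω) p) P := by
  simp only [MvPolynomial.eval_eq]
  exact integrable_finsetSum _ fun d hd => (hY.integrable_monomial (card_support_le hp hd)).const_mul _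

/-- The right-hand side does not involve `Y` or `P`, so any two `k`-wise independent standard normal
vectors share these expectations. -/
lemma integral_eval (hY : IsKWiseIndepStdNormals k Y P) {p : MvPolynomial (Fin n) ℝ}
    (hp : p.totalDegree ≤ k) : ∫ ω, MvPolynomial.eval (Y ω) p ∂P =
      ∑ d ∈ p.support, p.coeff d *
        ∫ x : d.support → ℝ, ∏ i, x i ^ d i ∂Measure.pi fun _ => gaussianReal 0 1 := by
  simp only [MvPolynomial.eval_eq]
  rw [integral_finsetSum _ fun d hd =>
    (hY.integrable_monomial (card_support_le hp hd)).const_mul _]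
  refine Finset.sum_congr rfl fun d hd => ?_
  rw [integral_const_mul, hY.integral_monomial (card_support_le hp hd)]

end IsKWiseIndepStdNormals

/-! ### Passage to the linear forms and conclusion -/

lemma IsIndepStdNormals.isKWise {n : ℕ} {Ω : Type*} [MeasurableSpace Ω]
    {X : Ω → EuclideanSpace ℝ (Fin n)} {P : Measure Ω} (hX : IsIndepStdNormals X P) (k : ℕ) :
    IsKWiseIndepStdNormals k X P :=
  ⟨hX.hasLaw, fun _ _ => hX.indep.precomp Subtype.val_injective⟩

/-- Under full independence `X` is a standard Gaussian vector, so a linear form is a centred normal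
with variance `‖a‖ ^ 2`. Only these marginals matter; the forms for different `a_i` may be
correlated. -/
lemma IsIndepStdNormals.map_inner {n : ℕ} {Ω : Type*} [MeasurableSpace Ω]
    {X : Ω → EuclideanSpace ℝ (Fin n)} {P : Measure Ω} (hX : IsIndepStdNormals X P)
    {a : EuclideanSpace ℝ (Fin n)} (ha : ‖a‖ = 1) :
    P.map (fun ω => inner ℝ a (X ω)) = gaussianReal 0 1 := by
  have h := hX.indep.hasLaw_pi hX.hasLaw
  have hstd : P.map X = stdGaussian (EuclideanSpace ℝ (Fin n)) := by
    rw [← map_pi_eq_stdGaussian, ← h.map_eq,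
      AEMeasurable.map_map_of_aemeasurable (by fun_prop) h.aemeasurable]
    rfl
  have hXm : AEMeasurable X P :=
    (WithLp.measurable_toLp 2 (Fin n → ℝ)).comp_aemeasurable h.aemeasurable
  have hL := IsGaussian.map_eq_gaussianReal (μ := stdGaussian (EuclideanSpace ℝ (Fin n)))
    (innerSL ℝ a)
  rw [integral_strongDual_stdGaussian, variance_dual_stdGaussian, innerSL_apply_norm, ha, ← hstd,
    AEMeasurable.map_map_of_aemeasurable (by fun_prop) hXm] at hL
  simpa [Function.comp_def] using hL

lemma MvPolynomial.totalDegree_aeval_le {σ τ R : Type*} [CommSemiring R]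
    (f : σ → MvPolynomial τ R) (hf : ∀ i, (f i).totalDegree ≤ 1) (q : MvPolynomial σ R) :
    (MvPolynomial.aeval f q).totalDegree ≤ q.totalDegree := by
  rw [MvPolynomial.aeval_def, MvPolynomial.eval₂_eq]
  refine MvPolynomial.totalDegree_finsetSum_le fun d hd => ?_
  refine (MvPolynomial.totalDegree_mul _ _).trans ?_
  rw [MvPolynomial.algebraMap_eq, MvPolynomial.totalDegree_C, zero_add]
  refine (MvPolynomial.totalDegree_finsetProd _ _).trans
    (le_trans (Finset.sum_le_sum fun i _ => ?_) (MvPolynomial.le_totalDegree hd))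
  refine (MvPolynomial.totalDegree_pow _ _).trans ?_
  simpa using Nat.mul_le_mul_left (d i) (hf i)

section

variable {n m k : ℕ} {Ω Ω' : Type*} [MeasurableSpace Ω] [MeasurableSpace Ω']
  {X : Ω → EuclideanSpace ℝ (Fin n)} {Y : Ω' → EuclideanSpace ℝ (Fin n)} {P : Measure Ω}
  {P' : Measure Ω'}

lemma IsKWiseIndepStdNormals.aemeasurable_inner (hY : IsKWiseIndepStdNormals k Y P')
    (a : Fin m → EuclideanSpace ℝ (Fin n)) :
    AEMeasurable (fun ω i => inner ℝ (a i) (Y ω)) P' := by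
  refine aemeasurable_pi_lambda _ fun i => ?_
  simp only [PiLp.inner_apply]
  exact Finset.aemeasurable_fun_sum _ fun j _ => (hY.hasLaw j).aemeasurable.const_inner

/-- Substituting linear forms into a polynomial does not raise its degree, so matching moments of
the coordinates give matching moments of the forms. -/
lemma momentsMatch_map_inner (hX : IsKWiseIndepStdNormals k X P)
    (hY : IsKWiseIndepStdNormals k Y P') (a : Fin m → EuclideanSpace ℝ (Fin n)) :
    MomentsMatch k (P.map fun ω i => inner ℝ (a i) (X ω))
      (P'.map fun ω i => inner ℝ (a i) (Y ω)) := by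
  set f : Fin m → MvPolynomial (Fin n) ℝ := fun i =>
    ∑ j, MvPolynomial.C (a i j) * MvPolynomial.X j with hf
  have hf1 : ∀ i, (f i).totalDegree ≤ 1 := fun i =>
    MvPolynomial.totalDegree_finsetSum_le fun j _ =>
      (MvPolynomial.totalDegree_mul _ _).trans (by simp)
  have heval : ∀ (x : EuclideanSpace ℝ (Fin n)) (q : MvPolynomial (Fin m) ℝ),
      MvPolynomial.eval (fun i => inner ℝ (a i) x) q =
        MvPolynomial.eval x (MvPolynomial.aeval f q) := by
    intro x q
    rw [← MvPolynomial.bind₁, MvPolynomial.eval, MvPolynomial.eval, MvPolynomial.eval₂Hom_bind₁]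
    congr 2
    ext i
    simp [hf, PiLp.inner_apply, mul_comm]
  have hdeg : ∀ q : MvPolynomial (Fin m) ℝ, q.totalDegree ≤ k →
      (MvPolynomial.aeval f q).totalDegree ≤ k := fun q hq =>
    (MvPolynomial.totalDegree_aeval_le f hf1 q).trans hq
  have hm : ∀ (q : MvPolynomial (Fin m) ℝ) (ρ : Measure (Fin m → ℝ)),
      AEStronglyMeasurable (fun x => MvPolynomial.eval x q) ρ := fun q ρ =>
    (MvPolynomial.continuous_eval q).aestronglyMeasurable
  refine ⟨fun q hq => ?_, fun q hq => ?_, fun q hq => ?_⟩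
  · rw [integrable_map_measure (hm q _) (hX.aemeasurable_inner a)]
    simpa only [Function.comp_def, heval] using hX.integrable_eval (hdeg q hq)
  · rw [integrable_map_measure (hm q _) (hY.aemeasurable_inner a)]
    simpa only [Function.comp_def, heval] using hY.integrable_eval (hdeg q hq)
  · rw [integral_map (hX.aemeasurable_inner a) (hm q _),
      integral_map (hY.aemeasurable_inner a) (hm q _)]
    simp only [heval]
    rw [hX.integral_eval (hdeg q hq), hY.integral_eval (hdeg q hq)]

lemma IsKWiseIndepStdNormals.measureReal_mem_iInter_openHalfspace
    (hY : IsKWiseIndepStdNormals k Y P') (a : Fin m → EuclideanSpace ℝ (Fin n)) (θ : Fin m → ℝ) :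
    P'.real {ω | Y ω ∈ ⋂ i, openHalfspace (a i) (θ i)} =
      (P'.map fun ω i => inner ℝ (a i) (Y ω)).real {x | ∀ i, θ i < x i} := by
  have hS : MeasurableSet {x : Fin m → ℝ | ∀ i, θ i < x i} := by
    rw [Set.ofPred_forall]
    exact MeasurableSet.iInter fun i => measurableSet_lt measurable_const (measurable_pi_apply i)
  rw [measureReal_def, measureReal_def,
    Measure.map_apply_of_aemeasurable (hY.aemeasurable_inner a) hS]
  congr 2
  ext ω
  simp [openHalfspace]

end

theorem mainTheorem9 :
    ∃ C : ℝ, 0 < C ∧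
      ∀ (n m k : ℕ) (ε : ℝ), 1 < m → 0 < ε → Even k → C * (m : ℝ) ^ 4 / ε ^ 2 ≤ (k : ℝ) →
      ∀ (a : Fin m → EuclideanSpace ℝ (Fin n)) (θ : Fin m → ℝ), (∀ i, ‖a i‖ = 1) →
      ∀ {Ω : Type*} [MeasurableSpace Ω] (P : Measure Ω) [IsProbabilityMeasure P]
        {Ω' : Type*} [MeasurableSpace Ω'] (P' : Measure Ω') [IsProbabilityMeasure P']
        (X : Ω → EuclideanSpace ℝ (Fin n)) (Y : Ω' → EuclideanSpace ℝ (Fin n)),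
        IsIndepStdNormals X P → IsKWiseIndepStdNormals k Y P' →
        |P.real {ω | X ω ∈ ⋂ i, openHalfspace (a i) (θ i)} -
          P'.real {ω | Y ω ∈ ⋂ i, openHalfspace (a i) (θ i)}| < ε := by
  obtain ⟨C, hC, h⟩ := exists_abs_measureReal_orthant_sub_lt
  refine ⟨C, hC, ?_⟩
  intro n m k ε hm hε hke hk a θ ha Ω _ P _ Ω' _ P' _ X Y hX hY
  have hXk := hX.isKWise k
  rw [hXk.measureReal_mem_iInter_openHalfspace, hY.measureReal_mem_iInter_openHalfspace]
  have := Measure.isProbabilityMeasure_map (hXk.aemeasurable_inner a)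
  have := Measure.isProbabilityMeasure_map (hY.aemeasurable_inner a)
  refine h m k ε (by omega) hε hke hk _ _ (momentsMatch_map_inner hXk hY a) (fun i => ?_) θ
  rw [AEMeasurable.map_map_of_aemeasurable (measurable_pi_apply i).aemeasurable
    (hXk.aemeasurable_inner a)]
  exact hX.map_inner (ha i)
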